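/- Let $\mathcal S,\mathcal A$ be finite nonempty sets, $P(\cdot\mid s,a)$ transition probabilities on $\mathcal S$, $\gamma\in[0,1)$, $r:\mathcal S\times\mathcal A\to[0,1]$ a reward, $g_1,\dots,g_n:\mathcal S\times\mathcal A\to[0,1]$ utilities, $\mathbf b\in[0,1/(1-\gamma)]^n$ thresholds, $\rho$ an initial distribution on $\mathcal S$ and $\tau>0$. Let $\Pi$ be the class of soft-max policies $\pi_\theta(a\mid s)=e^{\theta(s,a)}/\sum_{a'}e^{\theta(s,a')}$, $\theta\in\mathbb R^{\mathcal S\times\mathcal A}$. With $\mathbb E$ taken over trajectories $s_0\sim\rho$, $a_t\sim\pi(\cdot\mid s_t)$, $s_{t+1}\sim P(\cdot\mid s_t,a_t)$, put $$V_\tau^\pi(\rho)=\mathbb E\Big[\sum_{t\ge0}\gamma^t r(s_t,a_t)\Big]+\tau\,\mathbb E\Big[\sum_{t\ge0}-\gamma^t\log\pi(a_t\mid s_t)\Big],\qquad U_{g_i}^\pi(\rho)=\mathbb E\Big[\sum_{t\ge0}\gamma^t g_i(s_t,a_t)\Big],$$ where $\log$ is the natural logarithm, $U_{\mathbf g}^\pi(\rho)=(U_{g_1}^\pi(\rho),\dots,U_{g_n}^\pi(\rho))$,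 and for $\boldsymbol\lambda\in\mathbb R^n$ $$L(\pi,\boldsymbol\lambda)=V_\tau^\pi(\rho)+\boldsymbol\lambda^\top(U_{\mathbf g}^\pi(\rho)-\mathbf b),\qquad D(\boldsymbol\lambda)=\max_{\pi\in\Pi}L(\pi,\boldsymbol\lambda).$$ Assume that $d>0$ satisfies $d_\rho^\pi(s):=(1-\gamma)\sum_{t\ge0}\gamma^t\,\mathbb P(s_t=s\mid\pi,s_0\sim\rho)\ge d$ for all $s\in\mathcal S$ and $\pi\in\Pi$. Then: 1. For every $\boldsymbol\lambda\in\mathbb R^n$ the maximum defining $D(\boldsymbol\lambda)$ is attained, $D$ is differentiable at $\boldsymbol\lambda$, and for every maximizer $\pi_{\boldsymbol\lambda}\in\Pi$ of $L(\cdot,\boldsymbol\lambda)$ over $\Pi$, $\nabla D(\boldsymbol\lambda)=U_{\mathbf g}^{\pi_{\boldsymbol\lambda}}(\rho)-\mathbf b$. 2. Let $\overline\pi\in\Pi$ and $\boldsymbol\xi\in\mathbb R^n$ with $\xi_i>0$ and $U_{g_i}^{\overline\pi}(\rho)-b_i\ge\xi_i$ for all $i$, let $V_\tau^\star$ be the optimal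 value (supremum) of $V_\tau^\pi(\rho)$ over $\pi\in\Pi$ subject to $U_{\mathbf g}^\pi(\rho)\ge\mathbf b$, and let $\Lambda=\{\boldsymbol\lambda: 0\le\lambda_i\le (V_\tau^\star-V_\tau^{\overline\pi}(\rho))/\xi_i\ \text{for all } i\}$. Then $D$ is $\ell$-smooth on $\Lambda$, i.e. $\|\nabla D(\boldsymbol\lambda_1)-\nabla D(\boldsymbol\lambda_2)\|_2\le\ell\|\boldsymbol\lambda_1-\boldsymbol\lambda_2\|_2$ for all $\boldsymbol\lambda_1,\boldsymbol\lambda_2\in\Lambda$, where $$\ell=\frac{2\ln 2\,\big(n|\mathcal A|+(1-\gamma)^2\sqrt{n|\mathcal A|}\big)}{\tau(1-\gamma)^3 d}.$$ -/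

import Mathlib

open MeasureTheory ProbabilityTheory

noncomputable section

/-- A constrained Markov decision process `(S, A, P, r, g, b, γ)` with `n` constraints, on a finite
state space `S` and a finite action space `A`. -/
structure CMDP (S A : Type*) (n : ℕ) where
  /-- the transition probabilities `P(· | s, a)` -/
  P : S → A → PMF S
  /-- the reward -/
  r : S → A → ℝ
  r_mem : ∀ s a, r s a ∈ Set.Icc (0 : ℝ) 1
  /-- the utilities `g₁, …, gₙ` -/
  g : Fin n → S → A → ℝ
  g_mem : ∀ i s a, g i s a ∈ Set.Icc (0 : ℝ) 1
  /-- the discount factor -/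
  γ : ℝ
  γ_mem : γ ∈ Set.Ico (0 : ℝ) 1
  /-- the thresholds -/
  b : Fin n → ℝ
  b_mem : ∀ i, b i ∈ Set.Icc (0 : ℝ) (1 / (1 - γ))

/-- A stationary randomized policy: `π s` is the distribution of the action taken in state `s`. -/
abbrev Policy (S A : Type*) : Type _ := S → PMF A

/-- The soft-max policy `π_θ(a | s) = exp (θ s a) / ∑ a', exp (θ s a')`. -/
def softmaxPolicy {S A : Type*} [Fintype A] [Nonempty A] (θ : S → A → ℝ) : Policy S A :=
  fun s => PMF.ofFintype
    (fun a => ENNReal.ofReal (Real.exp (θ s a) / ∑ a', Real.exp (θ s a'))) (by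
      have hpos : 0 < ∑ a', Real.exp (θ s a') :=
        Finset.sum_pos (fun _ _ => Real.exp_pos _) Finset.univ_nonempty
      rw [← ENNReal.ofReal_sum_of_nonneg (fun a _ => by positivity), ← Finset.sum_div,
        div_self hpos.ne', ENNReal.ofReal_one])

/-- The class `Π` of all soft-max policies. -/
def softmaxClass (S A : Type*) [Fintype A] [Nonempty A] : Set (Policy S A) :=
  Set.range softmaxPolicy

namespace CMDP

variable {S A : Type*} {n : ℕ}

/-- One step of the state-action chain: from `(s, a)`, draw `s' ∼ P(· | s, a)`, then
`a' ∼ π(· | s')`. -/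
def step (M : CMDP S A n) (π : Policy S A) (x : S × A) : PMF (S × A) :=
  (M.P x.1 x.2).bind fun s' => (π s').map (Prod.mk s')

/-- The law of `(s₀, a₀)`: `s₀ ∼ ρ` and `a₀ ∼ π(· | s₀)`. -/
def initial (ρ : PMF S) (π : Policy S A) : PMF (S × A) :=
  ρ.bind fun s => (π s).map (Prod.mk s)

variable [Fintype S] [MeasurableSpace S] [MeasurableSingletonClass S]
variable [Fintype A] [MeasurableSpace A] [MeasurableSingletonClass A]

/-- `step` as a Markov kernel on `S × A`. -/
def stepKernel (M : CMDP S A n) (π : Policy S A) : Kernel (S × A) (S × A) where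
  toFun x := (M.step π x).toMeasure
  measurable' := Measurable.of_discrete

instance (M : CMDP S A n) (π : Policy S A) : IsMarkovKernel (M.stepKernel π) :=
  ⟨fun x => inferInstanceAs (IsProbabilityMeasure (M.step π x).toMeasure)⟩

/-- The law of the whole trajectory `(s₀, a₀), (s₁, a₁), …` under the policy `π` with `s₀ ∼ ρ`. -/
def trajLaw (M : CMDP S A n) (ρ : PMF S) (π : Policy S A) : Measure (ℕ → S × A) :=
  Kernel.trajMeasure (X := fun _ => S × A) (initial ρ π).toMeasure
    (fun t => (M.stepKernel π).comap
      (fun h : (i : Finset.Iic t) → S × A => h ⟨t, Finset.mem_Iic.2 le_rfl⟩)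
      (measurable_pi_apply _))

/-- `E[∑ₜ γᵗ f(sₜ, aₜ) | π, s₀ ∼ ρ]`. -/
def discounted (M : CMDP S A n) (ρ : PMF S) (π : Policy S A) (f : S → A → ℝ) : ℝ :=
  ∫ ω, ∑' t : ℕ, M.γ ^ t * f (ω t).1 (ω t).2 ∂(M.trajLaw ρ π)

/-- The value function `V^π(ρ)`. -/
def V (M : CMDP S A n) (ρ : PMF S) (π : Policy S A) : ℝ := M.discounted ρ π M.r

/-- The discounted utilities `U_g^π(ρ) ∈ ℝⁿ`. -/
def U (M : CMDP S A n) (ρ : PMF S) (π : Policy S A) : EuclideanSpace ℝ (Fin n) :=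
  WithLp.toLp 2 fun i => M.discounted ρ π (M.g i)

/-- The discounted entropy `H(ρ, π)`. -/
def entropy (M : CMDP S A n) (ρ : PMF S) (π : Policy S A) : ℝ :=
  M.discounted ρ π fun s a => -Real.log (π s a).toReal

/-- The entropy-regularized value function `V_τ^π(ρ)`. -/
def Vτ (M : CMDP S A n) (ρ : PMF S) (τ : ℝ) (π : Policy S A) : ℝ :=
  M.V ρ π + τ * M.entropy ρ π

/-- The discounted state visitation distribution
`d_ρ^π(s) = (1 - γ) ∑ₜ γᵗ P(sₜ = s | π, s₀ ∼ ρ)`. -/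
def visitation (M : CMDP S A n) (ρ : PMF S) (π : Policy S A) (s : S) : ℝ :=
  (1 - M.γ) * ∑' t : ℕ, M.γ ^ t * (M.trajLaw ρ π).real {ω | (ω t).1 = s}

/-- The threshold as a vector of `ℝⁿ`. -/
def bvec (M : CMDP S A n) : EuclideanSpace ℝ (Fin n) := WithLp.toLp 2 M.b

/-- The Lagrangian `L(π, lam) = V_τ^π(ρ) + lamᵀ (U_g^π(ρ) - b)`. -/
def lagrangian (M : CMDP S A n) (ρ : PMF S) (τ : ℝ) (π : Policy S A)
    (lam : EuclideanSpace ℝ (Fin n)) : ℝ :=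
  M.Vτ ρ τ π + ∑ i, lam i * (M.U ρ π i - M.b i)

variable [Nonempty A]

/-- `π` is a Lagrangian maximizer `π_lam` over the soft-max class. -/
def IsLagrangianMaximizer (M : CMDP S A n) (ρ : PMF S) (τ : ℝ)
    (lam : EuclideanSpace ℝ (Fin n)) (π : Policy S A) : Prop :=
  π ∈ softmaxClass S A ∧ ∀ π' ∈ softmaxClass S A, M.lagrangian ρ τ π' lam ≤ M.lagrangian ρ τ π lam

/-- The dual function: the supremum (a maximum, whenever a maximizer exists) of the Lagrangian
over the soft-max class. -/
def dual (M : CMDP S A n) (ρ : PMF S) (τ : ℝ) (lam : EuclideanSpace ℝ (Fin n)) : ℝ :=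
  sSup ((fun π => M.lagrangian ρ τ π lam) '' softmaxClass S A)

/-- The optimal value `V_τ^⋆` of the constrained problem
`max_{π ∈ Π} V_τ^π(ρ)` subject to `U_g^π(ρ) ≥ b`. -/
def optimalValue (M : CMDP S A n) (ρ : PMF S) (τ : ℝ) : ℝ :=
  sSup (M.Vτ ρ τ '' {π | π ∈ softmaxClass S A ∧ ∀ i, M.b i ≤ M.U ρ π i})

/-- If the constrained problem has an optimal policy, `optimalValue` is its value. -/
theorem optimalValue_eq (M : CMDP S A n) (ρ : PMF S) (τ : ℝ) (π : Policy S A)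
    (hπ : π ∈ softmaxClass S A ∧ ∀ i, M.b i ≤ M.U ρ π i)
    (hmax : ∀ π' ∈ softmaxClass S A, (∀ i, M.b i ≤ M.U ρ π' i) → M.Vτ ρ τ π' ≤ M.Vτ ρ τ π) :
    M.optimalValue ρ τ = M.Vτ ρ τ π := by
  refine IsGreatest.csSup_eq ⟨⟨π, hπ, rfl⟩, ?_⟩
  rintro _ ⟨π', hπ', rfl⟩
  exact hmax π' hπ'.1 hπ'.2

/-- The Slater condition with the strictly feasible policy `πbar` and the slack `ξ > 0`. -/
def IsSlater (M : CMDP S A n) (ρ : PMF S) (πbar : Policy S A) (ξ : Fin n → ℝ) : Prop :=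
  πbar ∈ softmaxClass S A ∧ ∀ i, 0 < ξ i ∧ ξ i ≤ M.U ρ πbar i - M.b i

/-- The box `Λ` of multipliers determined by a Slater policy `πbar` with slack `ξ`. -/
def multiplierBox (M : CMDP S A n) (ρ : PMF S) (τ : ℝ) (πbar : Policy S A) (ξ : Fin n → ℝ) :
    Set (EuclideanSpace ℝ (Fin n)) :=
  {lam | ∀ i, 0 ≤ lam i ∧ lam i ≤ (M.optimalValue ρ τ - M.Vτ ρ τ πbar) / ξ i}

end CMDP

/-- `f` is `ℓ`-smooth on `X`: it is differentiable at the points of `X`, and its gradient is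
`ℓ`-Lipschitz on `X` for the Euclidean norm. -/
def IsSmoothOn {n : ℕ} (ℓ : ℝ) (f : EuclideanSpace ℝ (Fin n) → ℝ)
    (X : Set (EuclideanSpace ℝ (Fin n))) : Prop :=
  (∀ x ∈ X, DifferentiableAt ℝ f x) ∧
    ∀ x ∈ X, ∀ y ∈ X, ‖gradient f x - gradient f y‖ ≤ ℓ * ‖x - y‖

end

/-! For fixed `lam`, let `W` solve the soft Bellman equation with reward `r + ∑ i, lam i * g i`, and
let `π₀` be its greedy soft-max policy. Substituting that equation into the Lagrangian and
telescoping gives, for every `π`, `L(π, lam) = L(π₀, lam) - τ E_π[∑ γ^t KL(π ‖ π₀)(s_t)]`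
(`exists_lagrangian_eq_sub_kl`). So `π₀` is a maximizer and the suboptimality gap is exactly a
discounted KL divergence.

Conversely, KL controls utilities: the performance difference identity, a Pinsker type inequality
and Cauchy-Schwarz (`sq_discounted_sub_le`) bound each squared utility difference from `π₀` by the
gap divided by `C = τ (1 - γ)^3`. This is quadratic growth measured in the utilities.

Since `L` is affine in `lam` with slope `U - b`, adding the growth bounds at two multipliers makes
the maximizers' utilities `n / (2C)`-Lipschitz in the multiplier (`norm_U_sub_U_le`). The same bound
makes the Danskin remainder quadratic, so `U - b` is the gradient of the dual. Finally `n / (2C)` is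
at most the stated `ℓ`. -/

noncomputable section

/-! ### Expectations under finite distributions. -/

/-- The expectation under a finitely supported mixture is the mixture of the expectations. -/
theorem PMF.sum_bind_toReal_mul {α β : Type*} [Fintype α] [Fintype β] (p : PMF α) (q : α → PMF β)
    (f : β → ℝ) :
    ∑ y, (p.bind q y).toReal * f y = ∑ x, (p x).toReal * ∑ y, (q x y).toReal * f y := by
  have h : ∀ y, (p.bind q y).toReal = ∑ x, (p x).toReal * (q x y).toReal := fun y => by
    rw [PMF.bind_apply, tsum_fintype, ENNReal.toReal_sum fun x _ =>
      ENNReal.mul_ne_top (p.apply_ne_top x) ((q x).apply_ne_top y)]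
    simp only [ENNReal.toReal_mul]
  simp only [h, Finset.sum_mul, Finset.mul_sum, mul_assoc]
  exact Finset.sum_comm

theorem PMF.sum_map_prodMk_toReal_mul {α β : Type*} [Fintype α] [Fintype β] (p : PMF β) (x : α)
    (f : α × β → ℝ) :
    ∑ z, (p.map (Prod.mk x) z).toReal * f z = ∑ y, (p y).toReal * f (x, y) := by
  classical
  have h := PMF.sum_bind_toReal_mul p (fun y => PMF.pure (x, y)) f
  rw [show p.map (Prod.mk x) = p.bind fun y => PMF.pure (x, y) from rfl, h]
  refine Finset.sum_congr rfl fun y _ => ?_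
  simp [PMF.pure_apply, apply_ite ENNReal.toReal]

theorem PMF.sum_toReal_eq_one {α : Type*} [Fintype α] (p : PMF α) : ∑ x, (p x).toReal = 1 := by
  rw [← ENNReal.toReal_sum fun x _ => p.apply_ne_top x, ← tsum_fintype (L := .unconditional _),
    p.tsum_coe, ENNReal.toReal_one]

/-! ### The Markov property and the calculus of discounted expectations. -/

namespace CMDP

variable {S A : Type*} {n : ℕ} [Fintype A]

/-- The average of `f s ·` over the actions taken by `π` in state `s`. -/
def actionMean (π : Policy S A) (f : S → A → ℝ) (s : S) : ℝ := ∑ a, (π s a).toReal * f s a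

theorem actionMean_state (π : Policy S A) (W : S → ℝ) :
    actionMean π (fun s _ => W s) = W := by
  funext s
  rw [actionMean, ← Finset.sum_mul, PMF.sum_toReal_eq_one, one_mul]

variable [Fintype S]

/-- The expectation of `W` at the next state. -/
def nextMean (M : CMDP S A n) (W : S → ℝ) (s : S) (a : A) : ℝ := ∑ s', (M.P s a s').toReal * W s'

theorem sum_initial_toReal_mul (ρ : PMF S) (π : Policy S A) (f : S → A → ℝ) :
    ∑ x, (initial ρ π x).toReal * f x.1 x.2 = ∑ s, (ρ s).toReal * actionMean π f s := by
  rw [initial, PMF.sum_bind_toReal_mul]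
  simp only [PMF.sum_map_prodMk_toReal_mul _ _ (fun x : S × A => f x.1 x.2), actionMean]

theorem sum_step_toReal_mul (M : CMDP S A n) (π : Policy S A) (x : S × A) (f : S → A → ℝ) :
    ∑ y, (M.step π x y).toReal * f y.1 y.2 = M.nextMean (actionMean π f) x.1 x.2 := by
  rw [step, PMF.sum_bind_toReal_mul]
  simp only [PMF.sum_map_prodMk_toReal_mul _ _ (fun x : S × A => f x.1 x.2), actionMean, nextMean]

variable [MeasurableSpace S] [MeasurableSingletonClass S]
variable [MeasurableSpace A] [MeasurableSingletonClass A]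

instance (M : CMDP S A n) (ρ : PMF S) (π : Policy S A) : IsProbabilityMeasure (M.trajLaw ρ π) := by
  unfold trajLaw; infer_instance

/-- The expectation of `f (s_t, a_t)`. -/
def meanAt (M : CMDP S A n) (ρ : PMF S) (π : Policy S A) (t : ℕ) (f : S → A → ℝ) : ℝ :=
  ∫ ω, f (ω t).1 (ω t).2 ∂(M.trajLaw ρ π)

theorem integrable_comp_eval (M : CMDP S A n) (ρ : PMF S) (π : Policy S A) (t : ℕ)
    (f : S → A → ℝ) : Integrable (fun ω => f (ω t).1 (ω t).2) (M.trajLaw ρ π) := by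
  have hm : Measurable fun x : S × A => f x.1 x.2 := Measurable.of_discrete
  refine Integrable.of_bound (C := ∑ x : S × A, |f x.1 x.2|)
    (hm.comp (measurable_pi_apply t)).aestronglyMeasurable (Filter.Eventually.of_forall fun ω => ?_)
  exact Finset.single_le_sum (f := fun x : S × A => |f x.1 x.2|) (fun _ _ => abs_nonneg _)
    (Finset.mem_univ (ω t))

theorem meanAt_zero (M : CMDP S A n) (ρ : PMF S) (π : Policy S A) (f : S → A → ℝ) :
    M.meanAt ρ π 0 f = ∑ s, (ρ s).toReal * actionMean π f s := by
  have hm : Measurable fun x : S × A => f x.1 x.2 := Measurable.of_discrete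
  have hmap : (M.trajLaw ρ π).map (fun ω => ω 0) = (initial ρ π).toMeasure := by
    have hf : (fun ω : ℕ → S × A => ω 0) =
        (fun x : (i : Finset.Iic 0) → S × A => x ⟨0, Finset.mem_Iic.2 le_rfl⟩) ∘
          (Preorder.frestrictLe (π := fun _ => S × A) 0) := rfl
    rw [hf, ← Measure.map_map (by fun_prop) (by fun_prop), trajLaw, Kernel.trajMeasure,
      Measure.map_comp _ _ (by fun_prop), Kernel.traj_map_frestrictLe, Kernel.partialTraj_self,
      Measure.id_comp, Measure.map_map (by fun_prop) (by fun_prop)]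
    exact Measure.map_id
  rw [meanAt, ← sum_initial_toReal_mul,
    ← integral_map (φ := fun ω : ℕ → S × A => ω 0) (f := fun x : S × A => f x.1 x.2)
      (measurable_pi_apply 0).aemeasurable hm.aestronglyMeasurable, hmap, PMF.integral_eq_sum]
  simp [smul_eq_mul]

/-- The Markov property: the joint law of the history up to `t` and the next pair is a
composition-product with `stepKernel`, which reads only the last pair of the history. -/
theorem meanAt_succ (M : CMDP S A n) (ρ : PMF S) (π : Policy S A) (t : ℕ) (f : S → A → ℝ) :
    M.meanAt ρ π (t + 1) f = M.meanAt ρ π t (M.nextMean (actionMean π f)) := by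
  have hm : Measurable fun x : S × A => f x.1 x.2 := Measurable.of_discrete
  have key := Kernel.map_frestrictLe_trajMeasure_compProd_eq_map_trajMeasure
    (X := fun _ => S × A) (μ₀ := (initial ρ π).toMeasure)
    (κ := fun t => (M.stepKernel π).comap
      (fun h : (i : Finset.Iic t) → S × A => h ⟨t, Finset.mem_Iic.2 le_rfl⟩)
      (measurable_pi_apply _)) (a := t)
  change (M.trajLaw ρ π).map _ ⊗ₘ _ = (M.trajLaw ρ π).map _ at key
  set F : ((i : Finset.Iic t) → S × A) × (S × A) → ℝ := fun z => f z.2.1 z.2.2 with hF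
  have hFm : Measurable F := hm.comp measurable_snd
  have hint : Integrable F ((M.trajLaw ρ π).map
      (fun x => (Preorder.frestrictLe (π := fun _ => S × A) t x, x (t + 1)))) := by
    rw [integrable_map_measure hFm.aestronglyMeasurable (by fun_prop)]
    exact M.integrable_comp_eval ρ π (t + 1) f
  have h1 : M.meanAt ρ π (t + 1) f = ∫ z, F z ∂((M.trajLaw ρ π).map
      (fun x => (Preorder.frestrictLe (π := fun _ => S × A) t x, x (t + 1)))) := by
    rw [integral_map (by fun_prop) hFm.aestronglyMeasurable]; rfl
  rw [h1, ← key, Measure.integral_compProd (by rw [key]; exact hint), integral_map (by fun_prop)]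
  · refine integral_congr_ae (Filter.Eventually.of_forall fun ω => ?_)
    change ∫ y, f y.1 y.2 ∂((M.step π (ω t)).toMeasure) = _
    rw [PMF.integral_eq_sum]
    exact M.sum_step_toReal_mul π (ω t) f
  · exact Measurable.of_discrete.aestronglyMeasurable

theorem abs_meanAt_le (M : CMDP S A n) (ρ : PMF S) (π : Policy S A) (t : ℕ) (f : S → A → ℝ) :
    |M.meanAt ρ π t f| ≤ ∑ x : S × A, |f x.1 x.2| := by
  have h := norm_integral_le_of_norm_le_const (μ := M.trajLaw ρ π)
    (f := fun ω => f (ω t).1 (ω t).2) (C := ∑ x : S × A, |f x.1 x.2|)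
    (Filter.Eventually.of_forall fun ω => Finset.single_le_sum
      (f := fun x : S × A => |f x.1 x.2|) (fun _ _ => abs_nonneg _) (Finset.mem_univ (ω t)))
  simpa [meanAt] using h

theorem summable_pow_mul_meanAt (M : CMDP S A n) (ρ : PMF S) (π : Policy S A) (f : S → A → ℝ) :
    Summable fun t => M.γ ^ t * M.meanAt ρ π t f := by
  refine Summable.of_norm_bounded (g := fun t => M.γ ^ t * ∑ x : S × A, |f x.1 x.2|)
    ((summable_geometric_of_lt_one M.γ_mem.1 M.γ_mem.2).mul_right _) fun t => ?_
  rw [norm_mul, Real.norm_of_nonneg (pow_nonneg M.γ_mem.1 t)]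
  exact mul_le_mul_of_nonneg_left (M.abs_meanAt_le ρ π t f) (pow_nonneg M.γ_mem.1 t)

theorem discounted_eq_tsum (M : CMDP S A n) (ρ : PMF S) (π : Policy S A) (f : S → A → ℝ) :
    M.discounted ρ π f = ∑' t, M.γ ^ t * M.meanAt ρ π t f := by
  have h := integral_tsum_of_summable_integral_norm (μ := M.trajLaw ρ π)
    (F := fun t ω => M.γ ^ t * f (ω t).1 (ω t).2)
    (fun t => (M.integrable_comp_eval ρ π t f).const_mul _) (by
      have := M.summable_pow_mul_meanAt ρ π (fun s a => |f s a|)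
      convert this using 2 with t
      simp only [norm_mul, Real.norm_of_nonneg (pow_nonneg M.γ_mem.1 t), integral_const_mul,
        meanAt, Real.norm_eq_abs])
  rw [discounted, ← h]
  simp only [integral_const_mul, meanAt]

theorem discounted_add (M : CMDP S A n) (ρ : PMF S) (π : Policy S A) (f g : S → A → ℝ) :
    M.discounted ρ π (fun s a => f s a + g s a) = M.discounted ρ π f + M.discounted ρ π g := by
  simp only [discounted_eq_tsum]
  rw [← (M.summable_pow_mul_meanAt ρ π f).tsum_add (M.summable_pow_mul_meanAt ρ π g)]
  refine tsum_congr fun t => ?_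
  rw [← mul_add, meanAt, integral_add (M.integrable_comp_eval ρ π t f)
    (M.integrable_comp_eval ρ π t g)]
  rfl

theorem discounted_const_mul (M : CMDP S A n) (ρ : PMF S) (π : Policy S A) (c : ℝ)
    (f : S → A → ℝ) :
    M.discounted ρ π (fun s a => c * f s a) = c * M.discounted ρ π f := by
  simp only [discounted_eq_tsum, meanAt, integral_const_mul, ← tsum_mul_left]
  exact tsum_congr fun t => by ring

theorem discounted_sub (M : CMDP S A n) (ρ : PMF S) (π : Policy S A) (f g : S → A → ℝ) :
    M.discounted ρ π (fun s a => f s a - g s a) = M.discounted ρ π f - M.discounted ρ π g := by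
  have h := M.discounted_add ρ π (fun s a => f s a - g s a) g
  simp only [sub_add_cancel] at h
  linarith

theorem discounted_sum (M : CMDP S A n) (ρ : PMF S) (π : Policy S A) {ι : Type*} (s : Finset ι)
    (f : ι → S → A → ℝ) :
    M.discounted ρ π (fun x a => ∑ i ∈ s, f i x a) = ∑ i ∈ s, M.discounted ρ π (f i) := by
  classical
  induction s using Finset.induction_on with
  | empty => simpa using M.discounted_const_mul ρ π 0 (fun _ _ => 0)
  | insert i s hi ih =>
    simp only [Finset.sum_insert hi, ← ih]
    exact M.discounted_add ρ π _ _

theorem discounted_const (M : CMDP S A n) (ρ : PMF S) (π : Policy S A) (c : ℝ) :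
    M.discounted ρ π (fun _ _ => c) = c / (1 - M.γ) := by
  simp [discounted_eq_tsum, meanAt, tsum_mul_right,
    tsum_geometric_of_lt_one M.γ_mem.1 M.γ_mem.2]
  ring

theorem discounted_nonneg (M : CMDP S A n) (ρ : PMF S) (π : Policy S A) {f : S → A → ℝ}
    (hf : ∀ s a, 0 ≤ f s a) : 0 ≤ M.discounted ρ π f :=
  integral_nonneg fun _ => tsum_nonneg fun t => mul_nonneg (pow_nonneg M.γ_mem.1 t) (hf _ _)

theorem discounted_mono (M : CMDP S A n) (ρ : PMF S) (π : Policy S A) {f g : S → A → ℝ}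
    (h : ∀ s a, f s a ≤ g s a) : M.discounted ρ π f ≤ M.discounted ρ π g := by
  have := M.discounted_nonneg ρ π (f := fun s a => g s a - f s a) fun s a => sub_nonneg.2 (h s a)
  rw [discounted_sub] at this
  linarith

/-- Averaging over the current action does not change the discounted value. -/
theorem discounted_actionMean (M : CMDP S A n) (ρ : PMF S) (π : Policy S A) (f : S → A → ℝ) :
    M.discounted ρ π (fun s _ => actionMean π f s) = M.discounted ρ π f := by
  simp only [discounted_eq_tsum]
  refine tsum_congr fun t => ?_
  cases t with
  | zero => rw [meanAt_zero, meanAt_zero, actionMean_state]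
  | succ t => rw [meanAt_succ, meanAt_succ, actionMean_state]

/-- Telescoping: the discounted value of the Bellman residual of `W` is the initial value. -/
theorem discounted_residual (M : CMDP S A n) (ρ : PMF S) (π : Policy S A) (W : S → ℝ) :
    M.discounted ρ π (fun s a => W s - M.γ * M.nextMean W s a) = ∑ s, (ρ s).toReal * W s := by
  -- Split off `t = 0`; by the Markov property the remaining terms are `γ` times the series for
  -- `nextMean W`.
  have h0 : M.discounted ρ π (fun s _ => W s) =
      (∑ s, (ρ s).toReal * W s) + M.γ * M.discounted ρ π (M.nextMean W) := by
    rw [discounted_eq_tsum, (M.summable_pow_mul_meanAt ρ π _).tsum_eq_zero_add, meanAt_zero,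
      actionMean_state, pow_zero, one_mul, discounted_eq_tsum, ← tsum_mul_left]
    congr 1
    refine tsum_congr fun t => ?_
    rw [meanAt_succ, actionMean_state]
    ring
  rw [discounted_sub, h0, discounted_const_mul]
  ring

/-- Serves to deduce `d ≤ 1`, through which `d` enters the comparison of constants. -/
theorem visitation_le_one (M : CMDP S A n) (ρ : PMF S) (π : Policy S A) (s : S) :
    M.visitation ρ π s ≤ 1 := by
  have hγ : 0 < 1 - M.γ := sub_pos.2 M.γ_mem.2
  have hg := summable_geometric_of_lt_one M.γ_mem.1 M.γ_mem.2
  have hle : ∀ t, M.γ ^ t * (M.trajLaw ρ π).real {ω | (ω t).1 = s} ≤ M.γ ^ t := fun t =>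
    mul_le_of_le_one_right (pow_nonneg M.γ_mem.1 t) measureReal_le_one
  have h : ∑' t, M.γ ^ t * (M.trajLaw ρ π).real {ω | (ω t).1 = s} ≤ ∑' t, M.γ ^ t :=
    Summable.tsum_le_tsum hle (Summable.of_nonneg_of_le
      (fun t => mul_nonneg (pow_nonneg M.γ_mem.1 t) measureReal_nonneg) hle hg) hg
  rw [tsum_geometric_of_lt_one M.γ_mem.1 M.γ_mem.2] at h
  calc M.visitation ρ π s ≤ (1 - M.γ) * (1 - M.γ)⁻¹ := mul_le_mul_of_nonneg_left h hγ.le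
    _ = 1 := mul_inv_cancel₀ hγ.ne'

end CMDP

/-! ### Soft-max policies and the KL divergence. -/

theorem softmaxPolicy_toReal {S A : Type*} [Fintype A] [Nonempty A] (θ : S → A → ℝ) (s : S)
    (a : A) : (softmaxPolicy θ s a).toReal = Real.exp (θ s a) / ∑ a', Real.exp (θ s a') := by
  rw [softmaxPolicy, PMF.ofFintype_apply, ENNReal.toReal_ofReal (by positivity)]

theorem toReal_pos_of_mem_softmaxClass {S A : Type*} [Fintype A] [Nonempty A] {π : Policy S A}
    (hπ : π ∈ softmaxClass S A) (s : S) (a : A) : 0 < (π s a).toReal := by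
  obtain ⟨θ, rfl⟩ := hπ
  rw [softmaxPolicy_toReal]
  exact div_pos (Real.exp_pos _)
    (Finset.sum_pos (fun _ _ => Real.exp_pos _) Finset.univ_nonempty)

/-- The Kullback-Leibler divergence dominates the squared Hellinger distance, pointwise form. -/
theorem sq_sqrt_sub_sqrt_le {p q : ℝ} (hp : 0 < p) (hq : 0 < q) :
    (√p - √q) ^ 2 ≤ p * (Real.log p - Real.log q) - p + q := by
  have hp' := Real.sqrt_pos.2 hp
  have hq' := Real.sqrt_pos.2 hq
  -- `log x ≤ x - 1` at `x = √q / √p`; multiplied by `2p` it reads `p (log p - log q) ≥ 2p - 2 √p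
  -- √q`.
  have h1 := Real.log_le_sub_one_of_pos (div_pos hq' hp')
  rw [Real.log_div hq'.ne' hp'.ne', Real.log_sqrt hq.le, Real.log_sqrt hp.le] at h1
  have h2 := mul_le_mul_of_nonneg_left h1 hp.le
  have h3 : p * (√q / √p - 1) = √p * √q - p := by
    rw [mul_sub, mul_one]
    congr 1
    rw [mul_div_assoc', div_eq_iff hp'.ne']
    nlinarith [Real.mul_self_sqrt hp.le]
  nlinarith [Real.sq_sqrt hp.le, Real.sq_sqrt hq.le]

/-- A Pinsker type inequality: expectations of a function with values in `[0, K]` under two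
distributions are controlled by their Kullback-Leibler divergence. -/
theorem sq_sum_sub_mul_le_kl {A : Type*} [Fintype A] {p q x : A → ℝ} {K : ℝ}
    (hp : ∀ a, 0 < p a) (hq : ∀ a, 0 < q a) (hp1 : ∑ a, p a = 1) (hq1 : ∑ a, q a = 1)
    (hx : ∀ a, x a ∈ Set.Icc 0 K) :
    (∑ a, (p a - q a) * x a) ^ 2 ≤ K ^ 2 * ∑ a, p a * (Real.log (p a) - Real.log (q a)) := by
  -- Factor `p - q` through square roots for Cauchy-Schwarz. Centering `x` at `K / 2` is free
  -- because both masses are 1, and it gives the constant `K ^ 2` instead of `4 * K ^ 2`.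
  have hc : ∑ a, (p a - q a) * x a =
      ∑ a, (√(p a) - √(q a)) * ((√(p a) + √(q a)) * (x a - K / 2)) := by
    have : ∀ a, (√(p a) - √(q a)) * ((√(p a) + √(q a)) * (x a - K / 2)) =
        (p a - q a) * x a - p a * (K / 2) + q a * (K / 2) := fun a => by
      linear_combination (x a - K / 2) * Real.sq_sqrt (hp a).le -
        (x a - K / 2) * Real.sq_sqrt (hq a).le
    simp only [this, Finset.sum_add_distrib, Finset.sum_sub_distrib, ← Finset.sum_mul, hp1, hq1]
    ring
  have hH : ∑ a, (√(p a) - √(q a)) ^ 2 ≤ ∑ a, p a * (Real.log (p a) - Real.log (q a)) := by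
    refine (Finset.sum_le_sum fun a _ => sq_sqrt_sub_sqrt_le (hp a) (hq a)).trans ?_
    simp only [Finset.sum_add_distrib, Finset.sum_sub_distrib, hp1, hq1]
    linarith
  have hB : ∑ a, ((√(p a) + √(q a)) * (x a - K / 2)) ^ 2 ≤ K ^ 2 := by
    have : ∀ a, ((√(p a) + √(q a)) * (x a - K / 2)) ^ 2 ≤ (p a + q a) * (K ^ 2 / 2) := fun a => by
      have h1 : (√(p a) + √(q a)) ^ 2 ≤ 2 * (p a + q a) := by
        nlinarith [sq_nonneg (√(p a) - √(q a)), Real.sq_sqrt (hp a).le, Real.sq_sqrt (hq a).le]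
      have h2 : (x a - K / 2) ^ 2 ≤ K ^ 2 / 4 := by nlinarith [(hx a).1, (hx a).2]
      rw [mul_pow]
      calc _ ≤ 2 * (p a + q a) * (K ^ 2 / 4) := mul_le_mul h1 h2 (sq_nonneg _)
            (by linarith [hp a, hq a])
        _ = _ := by ring
    refine (Finset.sum_le_sum fun a _ => this a).trans ?_
    rw [← Finset.sum_mul, Finset.sum_add_distrib, hp1, hq1]
    linarith
  rw [hc]
  refine (Finset.sum_mul_sq_le_sq_mul_sq _ _ _).trans ?_
  rw [mul_comm]
  exact mul_le_mul hB hH (Finset.sum_nonneg fun _ _ => sq_nonneg _) (sq_nonneg _)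

namespace CMDP

section

variable {S A : Type*} [Fintype A]

theorem actionMean_le_add (π : Policy S A) (s : S) {q q' : A → ℝ} {c : ℝ}
    (h : ∀ a, q a ≤ q' a + c) :
    ∑ a, (π s a).toReal * q a ≤ ∑ a, (π s a).toReal * q' a + c := by
  calc _ ≤ ∑ a, (π s a).toReal * (q' a + c) :=
        Finset.sum_le_sum fun a _ => mul_le_mul_of_nonneg_left (h a) ENNReal.toReal_nonneg
    _ = _ := by
        simp only [mul_add, Finset.sum_add_distrib]
        rw [← Finset.sum_mul, PMF.sum_toReal_eq_one, one_mul]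

/-- The Kullback-Leibler divergence of the action distributions in state `s`. -/
def klAt (π π' : Policy S A) (s : S) : ℝ :=
  actionMean π (fun s a => Real.log (π s a).toReal - Real.log (π' s a).toReal) s

theorem sq_actionMean_sub_le [Nonempty A] {π π' : Policy S A} (hπ : π ∈ softmaxClass S A)
    (hπ' : π' ∈ softmaxClass S A) {Q : S → A → ℝ} {K : ℝ} (hQ : ∀ s a, Q s a ∈ Set.Icc 0 K)
    (s : S) : (actionMean π Q s - actionMean π' Q s) ^ 2 ≤ K ^ 2 * klAt π π' s := by
  have h := sq_sum_sub_mul_le_kl (toReal_pos_of_mem_softmaxClass hπ s)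
    (toReal_pos_of_mem_softmaxClass hπ' s) (PMF.sum_toReal_eq_one _) (PMF.sum_toReal_eq_one _)
    (hQ s)
  simpa only [actionMean, klAt, sub_mul, Finset.sum_sub_distrib] using h

/-- Gibbs' inequality, read off from the Pinsker type bound for the zero function. -/
theorem klAt_nonneg [Nonempty A] {π π' : Policy S A} (hπ : π ∈ softmaxClass S A)
    (hπ' : π' ∈ softmaxClass S A) (s : S) : 0 ≤ klAt π π' s := by
  have h := sq_actionMean_sub_le hπ hπ' (Q := fun _ _ => 0) (K := 1) (fun _ _ => by simp) s
  simpa [actionMean] using h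

end

/-! ### Bellman equations, ordinary and soft. -/

variable {S A : Type*} {n : ℕ} [Fintype S]

theorem nextMean_const (M : CMDP S A n) (c : ℝ) (s : S) (a : A) :
    M.nextMean (fun _ => c) s a = c := by
  rw [nextMean, ← Finset.sum_mul, PMF.sum_toReal_eq_one, one_mul]

theorem nextMean_mono (M : CMDP S A n) {W W' : S → ℝ} (h : ∀ s, W s ≤ W' s) (s : S) (a : A) :
    M.nextMean W s a ≤ M.nextMean W' s a :=
  Finset.sum_le_sum fun s' _ => mul_le_mul_of_nonneg_left (h s') ENNReal.toReal_nonneg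

theorem nextMean_le_add (M : CMDP S A n) {W W' : S → ℝ} {c : ℝ} (h : ∀ s, W s ≤ W' s + c)
    (s : S) (a : A) : M.nextMean W s a ≤ M.nextMean W' s a + c := by
  refine (M.nextMean_mono h s a).trans_eq ?_
  have := M.nextMean_const c s a
  simp only [nextMean, mul_add, Finset.sum_add_distrib] at this ⊢
  rw [this]

/-- A Bellman equation whose state operators `Φ s` are monotone and nonexpansive has a solution. -/
theorem exists_bellman_fixedPoint (M : CMDP S A n) (f : S → A → ℝ) (Φ : S → (A → ℝ) → ℝ)
    (hΦ : ∀ s q q' c, (∀ a, q a ≤ q' a + c) → Φ s q ≤ Φ s q' + c) :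
    ∃ W : S → ℝ, ∀ s, W s = Φ s fun a => f s a + M.γ * M.nextMean W s a := by
  set T : (S → ℝ) → S → ℝ := fun W s => Φ s fun a => f s a + M.γ * M.nextMean W s a with hT
  -- This one-sided estimate, used in both orders, makes `T` a `γ`-contraction in the sup norm.
  have hle : ∀ W W' s, T W s ≤ T W' s + M.γ * dist W W' := fun W W' s => by
    refine hΦ s _ _ _ fun a => ?_
    have : M.nextMean W s a ≤ M.nextMean W' s a + dist W W' :=
      M.nextMean_le_add (fun s' => by
        have := (le_abs_self _).trans (dist_le_pi_dist W W' s')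
        linarith) s a
    nlinarith [M.γ_mem.1]
  have hc : ContractingWith ⟨M.γ, M.γ_mem.1⟩ T := by
    refine ⟨M.γ_mem.2, LipschitzWith.of_dist_le_mul fun W W' => ?_⟩
    refine (dist_pi_le_iff (mul_nonneg M.γ_mem.1 dist_nonneg)).2 fun s => abs_le.2 ⟨?_, ?_⟩
    · have := hle W' W s
      rw [dist_comm] at this
      change -(M.γ * dist W W') ≤ _
      linarith
    · have := hle W W' s
      change _ ≤ M.γ * dist W W'
      linarith
  exact ⟨hc.fixedPoint, fun s => (congrFun hc.fixedPoint_isFixedPt s).symm⟩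

variable [Fintype A]

/-- The action values of a policy for a utility with values in `[0, 1]`. -/
theorem exists_actionValue (M : CMDP S A n) (π : Policy S A) {f : S → A → ℝ}
    (hf : ∀ s a, f s a ∈ Set.Icc (0 : ℝ) 1) :
    ∃ Q : S → A → ℝ, (∀ s a, Q s a ∈ Set.Icc 0 (1 - M.γ)⁻¹) ∧
      ∀ s a, f s a = Q s a - M.γ * M.nextMean (actionMean π Q) s a := by
  have hγ : 0 < 1 - M.γ := sub_pos.2 M.γ_mem.2
  obtain ⟨W, hW⟩ := M.exists_bellman_fixedPoint f (fun s q => ∑ a, (π s a).toReal * q a)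
    fun s q q' c h => actionMean_le_add π s h
  set Q : S → A → ℝ := fun s a => f s a + M.γ * M.nextMean W s a with hQ
  have hWQ : actionMean π Q = W := funext fun s => (hW s).symm
  have hconst : ∀ s c, ∑ a, (π s a).toReal * c = c := fun s c => by
    rw [← Finset.sum_mul, PMF.sum_toReal_eq_one, one_mul]
  -- Minimum principle: at a minimizer `s₀` of `W` the Bellman equation gives `γ W s₀ ≤ W s₀`. The
  -- upper bound is the same argument at a maximizer.
  have hW0 : ∀ s, 0 ≤ W s := by
    intro s₁
    have : Nonempty S := ⟨s₁⟩
    obtain ⟨s₀, h₀⟩ := Finite.exists_min W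
    refine le_trans ?_ (h₀ s₁)
    have h : M.γ * W s₀ ≤ W s₀ := by
      conv_rhs => rw [hW s₀]
      rw [← hconst s₀ (M.γ * W s₀)]
      refine Finset.sum_le_sum fun a _ => mul_le_mul_of_nonneg_left ?_ ENNReal.toReal_nonneg
      have := M.nextMean_mono h₀ s₀ a
      rw [nextMean_const] at this
      nlinarith [(hf s₀ a).1, M.γ_mem.1]
    nlinarith
  have hW1 : ∀ s, W s ≤ (1 - M.γ)⁻¹ := by
    intro s₁
    have : Nonempty S := ⟨s₁⟩
    obtain ⟨s₀, h₀⟩ := Finite.exists_max W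
    refine (h₀ s₁).trans ?_
    have h : W s₀ ≤ 1 + M.γ * W s₀ := by
      conv_lhs => rw [hW s₀]
      rw [← hconst s₀ (1 + M.γ * W s₀)]
      refine Finset.sum_le_sum fun a _ => mul_le_mul_of_nonneg_left ?_ ENNReal.toReal_nonneg
      have := M.nextMean_mono h₀ s₀ a
      rw [nextMean_const] at this
      nlinarith [(hf s₀ a).2, M.γ_mem.1]
    rw [← one_div, le_div_iff₀ hγ]
    linarith
  refine ⟨Q, fun s a => ⟨?_, ?_⟩, fun s a => by rw [hWQ, hQ]; ring⟩
  · have := M.nextMean_mono hW0 s a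
    rw [nextMean_const] at this
    exact add_nonneg (hf s a).1 (mul_nonneg M.γ_mem.1 this)
  · have := M.nextMean_mono hW1 s a
    rw [nextMean_const] at this
    have h1 : f s a + M.γ * M.nextMean W s a ≤ 1 + M.γ * (1 - M.γ)⁻¹ :=
      add_le_add (hf s a).2 (mul_le_mul_of_nonneg_left this M.γ_mem.1)
    refine h1.trans_eq ?_
    field_simp
    ring

/-- The solution of the soft Bellman equation for the reward `f`, together with its greedy
soft-max policy. -/
theorem exists_soft_bellman [Nonempty A] (M : CMDP S A n) {τ : ℝ} (hτ : 0 < τ) (f : S → A → ℝ) :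
    ∃ π ∈ softmaxClass S A, ∃ W : S → ℝ, ∀ s a,
      f s a = τ * Real.log (π s a).toReal + (W s - M.γ * M.nextMean W s a) := by
  have hpos : ∀ q : A → ℝ, 0 < ∑ a, Real.exp (q a / τ) := fun q =>
    Finset.sum_pos (fun _ _ => Real.exp_pos _) Finset.univ_nonempty
  obtain ⟨W, hW⟩ := M.exists_bellman_fixedPoint f
    (fun _ q => τ * Real.log (∑ a, Real.exp (q a / τ))) (by
      intro s q q' c h
      -- Log-sum-exp is monotone, and adding `c` to its argument adds exactly `c` after scaling by
      -- `τ`.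
      have h1 : ∑ a, Real.exp (q a / τ) ≤ (∑ a, Real.exp (q' a / τ)) * Real.exp (c / τ) := by
        rw [Finset.sum_mul]
        refine Finset.sum_le_sum fun a _ => ?_
        rw [← Real.exp_add, ← add_div]
        exact Real.exp_le_exp.2 (div_le_div_of_nonneg_right (h a) hτ.le)
      have h2 := Real.log_le_log (hpos q) h1
      rw [Real.log_mul (hpos q').ne' (Real.exp_pos _).ne', Real.log_exp] at h2
      calc _ ≤ τ * (Real.log (∑ a, Real.exp (q' a / τ)) + c / τ) :=
            mul_le_mul_of_nonneg_left h2 hτ.le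
        _ = _ := by field_simp)
  -- With logits equal to the soft action values over `τ`, the log-normalizer in state `s` is `W s /
  -- τ`.
  refine ⟨_, ⟨fun s a => (f s a + M.γ * M.nextMean W s a) / τ, rfl⟩, W, fun s a => ?_⟩
  rw [softmaxPolicy_toReal, Real.log_div (Real.exp_pos _).ne' (hpos _).ne', Real.log_exp, mul_sub,
    ← hW s, mul_div_cancel₀ _ hτ.ne']
  ring

/-! ### Suboptimality gaps and utility differences as discounted expectations. -/

variable [MeasurableSpace S] [MeasurableSingletonClass S]
variable [MeasurableSpace A] [MeasurableSingletonClass A]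

/-- Cauchy-Schwarz for a discounted occupation measure of mass `1 / (1 - γ)`: the variance about the
normalized mean `m` is nonnegative. -/
theorem sq_discounted_le (M : CMDP S A n) (ρ : PMF S) (π : Policy S A) (h : S → A → ℝ) :
    M.discounted ρ π h ^ 2 ≤ (1 - M.γ)⁻¹ * M.discounted ρ π fun s a => h s a ^ 2 := by
  have hγ : 0 < 1 - M.γ := sub_pos.2 M.γ_mem.2
  set m := (1 - M.γ) * M.discounted ρ π h with hm
  have h0 := M.discounted_nonneg ρ π (f := fun s a => (h s a ^ 2 - 2 * m * h s a) + m ^ 2)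
    fun s a => by nlinarith [sq_nonneg (h s a - m)]
  rw [discounted_add, discounted_sub, discounted_const_mul, discounted_const] at h0
  have h1 : m ^ 2 / (1 - M.γ) = m * M.discounted ρ π h := by
    rw [hm]; field_simp
  rw [inv_mul_eq_div, le_div_iff₀ hγ]
  rw [h1] at h0
  nlinarith

theorem lagrangian_eq_discounted (M : CMDP S A n) (ρ : PMF S) (τ : ℝ) (π : Policy S A)
    (lam : EuclideanSpace ℝ (Fin n)) :
    M.lagrangian ρ τ π lam =
      M.discounted ρ π (fun s a => (M.r s a + ∑ i, lam i * M.g i s a) -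
        τ * Real.log (π s a).toReal) - ∑ i, lam i * M.b i := by
  have hH : M.entropy ρ π = -M.discounted ρ π fun s a => Real.log (π s a).toReal := by
    have := M.discounted_const_mul ρ π (-1) fun s a => Real.log (π s a).toReal
    simpa [entropy] using this
  rw [discounted_sub, discounted_add, discounted_const_mul, discounted_sum]
  simp only [discounted_const_mul, lagrangian, Vτ, V, U, hH, mul_sub, Finset.sum_sub_distrib]
  ring

/-- For a fixed policy the Lagrangian is affine in the multiplier; this is what turns utilities into
gradients. -/
theorem lagrangian_sub_lagrangian (M : CMDP S A n) (ρ : PMF S) (τ : ℝ) (π : Policy S A)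
    (x y : EuclideanSpace ℝ (Fin n)) :
    M.lagrangian ρ τ π y - M.lagrangian ρ τ π x = inner ℝ (M.U ρ π - M.bvec) (y - x) := by
  simp only [lagrangian, bvec, PiLp.inner_apply, PiLp.sub_apply, RCLike.inner_apply, conj_trivial,
    add_sub_add_left_eq_sub, ← Finset.sum_sub_distrib, sub_mul]

variable [Nonempty A]

/-- The utilities of two soft-max policies are close when the policies are close in
Kullback-Leibler divergence along the trajectories of one of them. -/
theorem sq_discounted_sub_le (M : CMDP S A n) (ρ : PMF S) {π π' : Policy S A}
    (hπ : π ∈ softmaxClass S A) (hπ' : π' ∈ softmaxClass S A) {f : S → A → ℝ}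
    (hf : ∀ s a, f s a ∈ Set.Icc (0 : ℝ) 1) :
    (M.discounted ρ π f - M.discounted ρ π' f) ^ 2 ≤
      ((1 - M.γ) ^ 3)⁻¹ * M.discounted ρ π fun s _ => klAt π π' s := by
  have hγ : 0 < 1 - M.γ := sub_pos.2 M.γ_mem.2
  obtain ⟨Q, hQ, hfQ⟩ := M.exists_actionValue π' hf
  -- Performance difference identity: the value of any `π₀` is the value of `π'` plus the discounted
  -- advantage of `π₀` over `π'`, computed with the action values `Q` of `π'`.
  have hval : ∀ π₀ : Policy S A, M.discounted ρ π₀ f =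
      M.discounted ρ π₀ (fun s _ => actionMean π₀ Q s - actionMean π' Q s) +
        ∑ s, (ρ s).toReal * actionMean π' Q s := fun π₀ => by
    rw [← M.discounted_residual ρ π₀, discounted_sub, discounted_actionMean,
      ← discounted_sub, ← discounted_add]
    congr 1
    funext s a
    rw [hfQ]
    ring
  have h0 : M.discounted ρ π' (fun s _ => actionMean π' Q s - actionMean π' Q s) = 0 := by
    rw [discounted_sub, sub_self]
  rw [hval π, hval π', h0, zero_add, add_sub_cancel_right]
  refine (M.sq_discounted_le ρ π _).trans ?_
  have h1 := M.discounted_mono ρ π fun s (_ : A) => sq_actionMean_sub_le hπ hπ' hQ s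
  rw [discounted_const_mul] at h1
  calc _ ≤ (1 - M.γ)⁻¹ * (((1 - M.γ)⁻¹) ^ 2 * M.discounted ρ π fun s _ => klAt π π' s) :=
        mul_le_mul_of_nonneg_left h1 (inv_nonneg.2 hγ.le)
    _ = _ := by rw [← mul_assoc, ← inv_pow]; ring

/-- The soft suboptimality identity. -/
theorem exists_lagrangian_eq_sub_kl (M : CMDP S A n) (ρ : PMF S) {τ : ℝ} (hτ : 0 < τ)
    (lam : EuclideanSpace ℝ (Fin n)) :
    ∃ π₀ ∈ softmaxClass S A, ∀ π : Policy S A, M.lagrangian ρ τ π lam =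
      M.lagrangian ρ τ π₀ lam - τ * M.discounted ρ π fun s _ => klAt π π₀ s := by
  obtain ⟨π₀, hπ₀, W, hW⟩ := M.exists_soft_bellman hτ fun s a => M.r s a + ∑ i, lam i * M.g i s a
  -- The soft Bellman equation turns the regularized reward into a Bellman residual of `W`, which
  -- telescopes, minus `τ` times a log-ratio, which averages to KL.
  have hL : ∀ π : Policy S A, M.lagrangian ρ τ π lam =
      (∑ s, (ρ s).toReal * W s) - (∑ i, lam i * M.b i) -
        τ * M.discounted ρ π fun s _ => klAt π π₀ s := fun π => by
    rw [lagrangian_eq_discounted, ← M.discounted_residual ρ π]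
    simp only [klAt]
    rw [discounted_actionMean, ← discounted_const_mul, sub_right_comm, ← discounted_sub]
    congr 2
    funext s a
    rw [hW]
    ring
  refine ⟨π₀, hπ₀, fun π => ?_⟩
  have h0 : (M.discounted ρ π₀ fun s _ => klAt π₀ π₀ s) = 0 := by
    simp [klAt, actionMean, discounted_const]
  rw [hL π, hL π₀, h0]
  ring

end CMDP

/-! ### Quadratic growth, Lipschitz utilities and the gradient of the dual. -/

namespace CMDP

variable {S A : Type*} {n : ℕ} [Fintype S] [Fintype A] [Nonempty A]
variable [MeasurableSpace S] [MeasurableSingletonClass S]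
variable [MeasurableSpace A] [MeasurableSingletonClass A]

theorem exists_isLagrangianMaximizer_quadratic_growth (M : CMDP S A n) (ρ : PMF S) {τ : ℝ}
    (hτ : 0 < τ) (lam : EuclideanSpace ℝ (Fin n)) :
    ∃ π₀, M.IsLagrangianMaximizer ρ τ lam π₀ ∧ ∀ π ∈ softmaxClass S A, ∀ i,
      (M.U ρ π i - M.U ρ π₀ i) ^ 2 ≤ (τ * (1 - M.γ) ^ 3)⁻¹ *
        (M.lagrangian ρ τ π₀ lam - M.lagrangian ρ τ π lam) := by
  obtain ⟨π₀, hπ₀, h⟩ := M.exists_lagrangian_eq_sub_kl ρ hτ lam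
  refine ⟨π₀, ⟨hπ₀, fun π hπ => ?_⟩, fun π hπ i => ?_⟩
  · rw [h π]
    have := M.discounted_nonneg ρ π (f := fun s _ => klAt π π₀ s) fun s _ => klAt_nonneg hπ hπ₀ s
    nlinarith
  · refine (M.sq_discounted_sub_le ρ hπ hπ₀ (M.g_mem i)).trans_eq ?_
    rw [h π, sub_sub_cancel, mul_inv, mul_comm τ⁻¹, mul_assoc, inv_mul_cancel_left₀ hτ.ne']

/-- Quadratic growth of the Lagrangian at each of its maximizers, in terms of the utilities. -/
theorem IsLagrangianMaximizer.sq_U_sub_le {M : CMDP S A n} {ρ : PMF S} {τ : ℝ} (hτ : 0 < τ)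
    {lam : EuclideanSpace ℝ (Fin n)} {π₀ π : Policy S A}
    (h₀ : M.IsLagrangianMaximizer ρ τ lam π₀) (hπ : π ∈ softmaxClass S A) (i : Fin n) :
    (M.U ρ π i - M.U ρ π₀ i) ^ 2 ≤ (τ * (1 - M.γ) ^ 3)⁻¹ *
      (M.lagrangian ρ τ π₀ lam - M.lagrangian ρ τ π lam) := by
  obtain ⟨π₁, h₁, hg⟩ := M.exists_isLagrangianMaximizer_quadratic_growth ρ hτ lam
  have hL : M.lagrangian ρ τ π₁ lam = M.lagrangian ρ τ π₀ lam :=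
    le_antisymm (h₀.2 _ h₁.1) (h₁.2 _ h₀.1)
  -- A zero gap forces equal utilities, so growth at one maximizer transfers to all of them.
  have hU : M.U ρ π₀ i = M.U ρ π₁ i := by
    have := hg π₀ h₀.1 i
    rw [hL, sub_self, mul_zero] at this
    exact sub_eq_zero.1 (pow_eq_zero_iff two_ne_zero |>.1 (le_antisymm this (sq_nonneg _)))
  rw [hU, ← hL]
  exact hg π hπ i

theorem IsLagrangianMaximizer.dual_eq {M : CMDP S A n} {ρ : PMF S} {τ : ℝ}
    {lam : EuclideanSpace ℝ (Fin n)} {π : Policy S A} (h : M.IsLagrangianMaximizer ρ τ lam π) :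
    M.dual ρ τ lam = M.lagrangian ρ τ π lam := by
  refine IsGreatest.csSup_eq ⟨⟨π, h.1, rfl⟩, ?_⟩
  rintro _ ⟨π', hπ', rfl⟩
  exact h.2 π' hπ'

/-- The utilities of the Lagrangian maximizers are Lipschitz in the multiplier. -/
theorem norm_U_sub_U_le (M : CMDP S A n) (ρ : PMF S) {τ : ℝ} (hτ : 0 < τ)
    {x y : EuclideanSpace ℝ (Fin n)} {π₁ π₂ : Policy S A}
    (h₁ : M.IsLagrangianMaximizer ρ τ x π₁) (h₂ : M.IsLagrangianMaximizer ρ τ y π₂) :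
    ‖M.U ρ π₁ - M.U ρ π₂‖ ≤ n / (2 * (τ * (1 - M.γ) ^ 3)) * ‖x - y‖ := by
  have hγ : 0 < 1 - M.γ := sub_pos.2 M.γ_mem.2
  have hC : 0 < τ * (1 - M.γ) ^ 3 := by positivity
  set C := τ * (1 - M.γ) ^ 3
  -- In the sum of the two gaps the regularized values cancel, leaving only the terms linear in the
  -- multipliers.
  have hI : (M.lagrangian ρ τ π₁ x - M.lagrangian ρ τ π₂ x) +
      (M.lagrangian ρ τ π₂ y - M.lagrangian ρ τ π₁ y) =
        inner ℝ (M.U ρ π₁ - M.U ρ π₂) (x - y) := by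
    have e₁ := M.lagrangian_sub_lagrangian ρ τ π₁ y x
    have e₂ := M.lagrangian_sub_lagrangian ρ τ π₂ y x
    have : M.U ρ π₁ - M.U ρ π₂ = (M.U ρ π₁ - M.bvec) - (M.U ρ π₂ - M.bvec) := by abel
    rw [this, inner_sub_left, ← e₁, ← e₂]
    ring
  -- Both growth bounds control the same square, so averaging them produces the factor `1 / 2`.
  have hi : ∀ i, (M.U ρ π₁ i - M.U ρ π₂ i) ^ 2 ≤
      (2 * C)⁻¹ * inner ℝ (M.U ρ π₁ - M.U ρ π₂) (x - y) := fun i => by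
    have a₁ := h₁.sq_U_sub_le hτ h₂.1 i
    have a₂ := h₂.sq_U_sub_le hτ h₁.1 i
    rw [← hI, mul_inv]
    nlinarith
  have hn : ‖M.U ρ π₁ - M.U ρ π₂‖ ^ 2 ≤
      n / (2 * C) * (‖M.U ρ π₁ - M.U ρ π₂‖ * ‖x - y‖) := by
    calc ‖M.U ρ π₁ - M.U ρ π₂‖ ^ 2
        = ∑ i, (M.U ρ π₁ i - M.U ρ π₂ i) ^ 2 := by
          simp [EuclideanSpace.norm_sq_eq]
      _ ≤ ∑ _i : Fin n, (2 * C)⁻¹ * inner ℝ (M.U ρ π₁ - M.U ρ π₂) (x - y) :=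
          Finset.sum_le_sum fun i _ => hi i
      _ = n / (2 * C) * inner ℝ (M.U ρ π₁ - M.U ρ π₂) (x - y) := by
          rw [Finset.sum_const, Finset.card_univ, Fintype.card_fin, nsmul_eq_mul, ← mul_assoc,
            div_eq_mul_inv]
      _ ≤ _ := mul_le_mul_of_nonneg_left (real_inner_le_norm _ _) (by positivity)
  rcases (norm_nonneg (M.U ρ π₁ - M.U ρ π₂)).eq_or_lt with h0 | h0
  · rw [← h0]
    positivity
  · refine le_of_mul_le_mul_left ?_ h0
    calc _ = ‖M.U ρ π₁ - M.U ρ π₂‖ ^ 2 := (sq _).symm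
      _ ≤ _ := hn
      _ = _ := by ring

/-- Danskin's theorem for the dual function. -/
theorem IsLagrangianMaximizer.hasGradientAt_dual {M : CMDP S A n} {ρ : PMF S} {τ : ℝ}
    (hτ : 0 < τ) {lam : EuclideanSpace ℝ (Fin n)} {π : Policy S A}
    (h : M.IsLagrangianMaximizer ρ τ lam π) :
    HasGradientAt (M.dual ρ τ) (M.U ρ π - M.bvec) lam := by
  rw [hasGradientAt_iff_isLittleO]
  refine Asymptotics.IsBigO.trans_isLittleO (g := fun y => ‖y - lam‖ ^ 2) ?_
    (Asymptotics.isLittleO_pow_sub_sub lam one_lt_two)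
  refine Asymptotics.IsBigO.of_bound (n / (2 * (τ * (1 - M.γ) ^ 3)))
    (Filter.Eventually.of_forall fun y => ?_)
  obtain ⟨π', h', -⟩ := M.exists_isLagrangianMaximizer_quadratic_growth ρ hτ y
  have e := M.lagrangian_sub_lagrangian ρ τ π lam y
  have e' := M.lagrangian_sub_lagrangian ρ τ π' lam y
  have hlow := h'.2 π h.1
  have hup := h.2 π' h'.1
  -- The Danskin remainder is `L(π', y) - L(π, y) ≥ 0`. As `L(π', lam) ≤ L(π, lam)`, it is at most
  -- the difference of inner products bounded here.
  have hb : inner ℝ (M.U ρ π' - M.bvec) (y - lam) - inner ℝ (M.U ρ π - M.bvec) (y - lam) ≤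
      n / (2 * (τ * (1 - M.γ) ^ 3)) * ‖y - lam‖ ^ 2 := by
    rw [← inner_sub_left, sub_sub_sub_cancel_right]
    refine (real_inner_le_norm _ _).trans ?_
    rw [sq, ← mul_assoc]
    exact mul_le_mul_of_nonneg_right (M.norm_U_sub_U_le ρ hτ h' h) (norm_nonneg _)
  rw [h.dual_eq, h'.dual_eq, Real.norm_eq_abs, norm_pow, norm_norm, abs_of_nonneg (by linarith)]
  linarith

/-- With `m` the number of actions, the comparison rests on `m ≥ 1`, `2 log 2 ≥ 1 / 2` and `d ≤ 1`;
the square-root term is merely nonnegative. -/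
theorem lipschitz_const_le {n m γ τ d : ℝ} (hn : 0 ≤ n) (hm : 1 ≤ m) (hγ : γ < 1) (hτ : 0 < τ)
    (hd : 0 < d) (hd1 : d ≤ 1) :
    n / (2 * (τ * (1 - γ) ^ 3)) ≤
      2 * Real.log 2 * (n * m + (1 - γ) ^ 2 * √(n * m)) / (τ * (1 - γ) ^ 3 * d) := by
  have hγ' : 0 < 1 - γ := sub_pos.2 hγ
  have hC : 0 < τ * (1 - γ) ^ 3 := by positivity
  have h1 : n / 2 ≤ 2 * Real.log 2 * (n * m + (1 - γ) ^ 2 * √(n * m)) := by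
    have h2 : n ≤ n * m + (1 - γ) ^ 2 * √(n * m) := by
      have : 0 ≤ (1 - γ) ^ 2 * √(n * m) := by positivity
      nlinarith
    nlinarith [Real.log_two_gt_d9]
  rw [← div_div]
  exact div_le_div₀ (by linarith) h1 (by positivity) (mul_le_of_le_one_right hC.le hd1)

end CMDP

end

theorem proposition3 {S A : Type*} [Fintype S] [MeasurableSpace S] [MeasurableSingletonClass S]
    [Fintype A] [Nonempty A] [MeasurableSpace A] [MeasurableSingletonClass A]
    {n : ℕ} (M : CMDP S A n) (ρ : PMF S) (τ : ℝ) (hτ : 0 < τ)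
    (d : ℝ) (hd : 0 < d) (hexp : ∀ π ∈ softmaxClass S A, ∀ s, d ≤ M.visitation ρ π s) :
    (∀ lam : EuclideanSpace ℝ (Fin n), ∃ π, M.IsLagrangianMaximizer ρ τ lam π) ∧
    (∀ (lam : EuclideanSpace ℝ (Fin n)) (π : Policy S A), M.IsLagrangianMaximizer ρ τ lam π →
      HasGradientAt (M.dual ρ τ) (M.U ρ π - M.bvec) lam) ∧
    (∀ (πbar : Policy S A) (ξ : Fin n → ℝ), M.IsSlater ρ πbar ξ →
      IsSmoothOn
        (2 * Real.log 2 *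
            (n * (Fintype.card A : ℝ) + (1 - M.γ) ^ 2 * √(n * (Fintype.card A : ℝ))) /
          (τ * (1 - M.γ) ^ 3 * d))
        (M.dual ρ τ) (M.multiplierBox ρ τ πbar ξ)) := by
  have hex : ∀ lam : EuclideanSpace ℝ (Fin n), ∃ π, M.IsLagrangianMaximizer ρ τ lam π :=
    fun lam => (M.exists_isLagrangianMaximizer_quadratic_growth ρ hτ lam).imp fun _ h => h.1
  refine ⟨hex, fun lam π h => h.hasGradientAt_dual hτ, fun πbar ξ _ => ⟨fun x _ => ?_,
    fun x _ y _ => ?_⟩⟩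
  · obtain ⟨π, h⟩ := hex x
    exact (h.hasGradientAt_dual hτ).differentiableAt
  · obtain ⟨π₁, h₁⟩ := hex x
    obtain ⟨π₂, h₂⟩ := hex y
    rw [(h₁.hasGradientAt_dual hτ).gradient, (h₂.hasGradientAt_dual hτ).gradient,
      sub_sub_sub_cancel_right]
    -- Some state is needed to conclude `d ≤ 1` from the visitation bounds; the support of `ρ`
    -- supplies one.
    obtain ⟨s, -⟩ := ρ.support_nonempty
    refine (M.norm_U_sub_U_le ρ hτ h₁ h₂).trans (mul_le_mul_of_nonneg_right ?_ (norm_nonneg _))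
    exact CMDP.lipschitz_const_le n.cast_nonneg (mod_cast Fintype.card_pos) M.γ_mem.2 hτ hd
      ((hexp π₁ h₁.1 s).trans (M.visitation_le_one ρ π₁ s))
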